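/- Let $n\ge 4$ and let $\mathbb R^{n+1}_1$ be Minkowski space with the Lorentzian inner product $\langle\cdot,\cdot\rangle$ of signature $(n,1)$; write $v^2=\langle v,v\rangle$. A *sphere of codimension two* is an $(n-1)$-dimensional cross-section of a space-like hypersphere $(y-c)^2=-r^2$, $r>0$, with a hyperplane. Let $M$ be a *canal space-like hypersurface* in $\mathbb R^{n+1}_1$: $M$ is given by a smooth position vector $Z=Z(s;u^1,\dots,u^{n-1})$ on an open set of parameters $(s,u)\in\Omega\subset\mathbb R\times\mathbb R^{n-1}$, the induced metric $g$ is positive definite, for every fixed $s$ the points $Z(s;u)$ lie on a sphere of codimension two, and the normals to $M$ at all these points pass through a fixed point $z(s)$, where $z$ is a smooth curve. Let $R(s)>0$ be the radius of the hypersphere with center $z(s)$ that contains these points, $(Z(s;u)-z(s))^2=-R(s)^2$. Suppose that $M$ is of *hyperbolic type*, i.e. the curve of centers is space-like: $z'(s)^2>0$. Put $$N=-\frac{Z-z}{R},\qquad \xi=\frac{z'-R'N}{\sqrt{(z'-R'N)^2}},\qquad \eta=g(\xi,\cdot).$$ Then $(z'-R'N)^2>0$, $\xi$ is a smooth unit tangent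 vector field on $M$, and $(M,g,\xi)$ is a Riemannian manifold of quasi-constant sectional curvatures (a QC-manifold): the sectional curvature of a 2-plane in $T_pM$ only depends on $p$ and on the angle between the plane and $\xi$. Moreover there are functions $a,b,k$ on $M$, with $b\neq 0$ everywhere, such that the curvature tensor of $g$ is $\mathcal R=a\,\pi+b\,\Phi$, where $$\pi(X,Y,W,U)=g(Y,W)g(X,U)-g(X,W)g(Y,U),$$ $$\Phi(X,Y,W,U)=g(Y,W)\eta(X)\eta(U)-g(X,W)\eta(Y)\eta(U)+g(X,U)\eta(Y)\eta(W)-g(Y,U)\eta(X)\eta(W),$$ such that $\nabla_x\xi=k\,x$ for all $x\perp\xi$, with $k=\xi(a)/(2b)$, and $$a=-\frac1{R^2},\qquad a+k^2=-\frac{1}{R^2(\dot R^2+1)}<0,$$ where $\dot R=R'/\sqrt{z'^2}$ is the derivative of $R$ with respect to the natural parameter of the curve of centers (so $\dot R=R'$ if $z'^2=1$). -/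

import Mathlib

open scoped ContDiff

noncomputable section

/-! ## Riemannian geometry on an open set of a finite-dimensional vector space

A metric is a map `g : E → E →L[ℝ] E →L[ℝ] ℝ`, used on an open set `Ω` of the finite-dimensional
space `E`. All tangent spaces are identified with `E`, and tensors are evaluated on vectors of `E`,
extended as constant (coordinate) vector fields where a derivative is taken. -/

section RiemannianPatch

variable {E : Type*} [NormedAddCommGroup E] [NormedSpace ℝ E]

/-- `g` is a smooth Riemannian metric on the open set `Ω`. -/
structure IsRiemannianMetricOn (Ω : Set E) (g : E → E →L[ℝ] E →L[ℝ] ℝ) : Prop where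
  isOpen : IsOpen Ω
  smooth : ContDiffOn ℝ ∞ g Ω
  symm : ∀ p ∈ Ω, ∀ X Y : E, g p X Y = g p Y X
  pos : ∀ p ∈ Ω, ∀ X : E, X ≠ 0 → 0 < g p X X

/-- The Christoffel symbols of the first kind, as the linear form
`W ↦ ½ ((∂_X g)(Y, W) + (∂_Y g)(X, W) - (∂_W g)(X, Y))`. -/
def christoffelForm (g : E → E →L[ℝ] E →L[ℝ] ℝ) (p X Y : E) : E →L[ℝ] ℝ :=
  (1 / 2 : ℝ) • (fderiv ℝ g p X Y + fderiv ℝ g p Y X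
    - (ContinuousLinearMap.apply ℝ ℝ Y).comp
        ((ContinuousLinearMap.apply ℝ (E →L[ℝ] ℝ) X).comp (fderiv ℝ g p)))

theorem christoffelForm_apply (g : E → E →L[ℝ] E →L[ℝ] ℝ) (p X Y W : E) :
    christoffelForm g p X Y W
      = (1 / 2) * (fderiv ℝ g p X Y W + fderiv ℝ g p Y X W - fderiv ℝ g p W X Y) := by
  simp [christoffelForm]

/-- The Christoffel symbols `Γ_p(X, Y)` of the second kind: the vector that represents
`christoffelForm g p X Y` with respect to `g p`. -/
def christoffel (g : E → E →L[ℝ] E →L[ℝ] ℝ) (p X Y : E) : E :=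
  (g p).inverse (christoffelForm g p X Y)

/-- The Levi-Civita covariant derivative `(∇_X V)(p)` of the vector field `V`. -/
def leviCivita (g : E → E →L[ℝ] E →L[ℝ] ℝ) (V : E → E) (p X : E) : E :=
  fderiv ℝ V p X + christoffel g p X (V p)

/-- The curvature `R(X, Y) W = ∇_X ∇_Y W - ∇_Y ∇_X W` at `p`, where the vectors `X`, `Y`, `W` are
extended as constant vector fields (so that `[X, Y] = 0`). -/
def curvatureOperator (g : E → E →L[ℝ] E →L[ℝ] ℝ) (p X Y W : E) : E :=
  leviCivita g (fun q => leviCivita g (fun _ => W) q Y) p X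
    - leviCivita g (fun q => leviCivita g (fun _ => W) q X) p Y

/-- The Riemannian curvature tensor `𝓡(X, Y, W, U) = g(R(X, Y) W, U)`. -/
def curvatureTensor (g : E → E →L[ℝ] E →L[ℝ] ℝ) (p X Y W U : E) : ℝ :=
  g p (curvatureOperator g p X Y W) U

/-- `π(X, Y, W, U) = g(Y, W) g(X, U) - g(X, W) g(Y, U)`. -/
def tensorPi (g : E → E →L[ℝ] E →L[ℝ] ℝ) (p X Y W U : E) : ℝ :=
  g p Y W * g p X U - g p X W * g p Y U

/-- `Φ(X, Y, W, U) = g(Y, W) η(X) η(U) - g(X, W) η(Y) η(U) + g(X, U) η(Y) η(W) - g(Y, U) η(X) η(W)`,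
with `η(X) = g(ξ, X)`. -/
def tensorPhi (g : E → E →L[ℝ] E →L[ℝ] ℝ) (ξ : E → E) (p X Y W U : E) : ℝ :=
  g p Y W * (g p (ξ p) X * g p (ξ p) U) - g p X W * (g p (ξ p) Y * g p (ξ p) U)
    + g p X U * (g p (ξ p) Y * g p (ξ p) W) - g p Y U * (g p (ξ p) X * g p (ξ p) W)

/-- The sectional curvature of the plane spanned by the linearly independent vectors `X`, `Y`. -/
def sectionalCurvature (g : E → E →L[ℝ] E →L[ℝ] ℝ) (p X Y : E) : ℝ :=
  curvatureTensor g p X Y Y X / tensorPi g p X Y Y X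

/-- `X`, `Y` are orthonormal at `p`. -/
def IsOrthonormalPair (g : E → E →L[ℝ] E →L[ℝ] ℝ) (p X Y : E) : Prop :=
  g p X X = 1 ∧ g p Y Y = 1 ∧ g p X Y = 0

/-- The angle between the unit vector `ξ p` and the plane with orthonormal basis `X`, `Y`: its
cosine is the length of the orthogonal projection of `ξ p` to the plane. -/
def angleToPlane (g : E → E →L[ℝ] E →L[ℝ] ℝ) (ξ : E → E) (p X Y : E) : ℝ :=
  Real.arccos (Real.sqrt ((g p (ξ p) X) ^ 2 + (g p (ξ p) Y) ^ 2))

/-- `(Ω, g, ξ)` is a Riemannian manifold of quasi-constant sectional curvatures: `ξ` is a smooth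
unit vector field, and the sectional curvature of a 2-plane in a tangent space only depends on the
point and on the angle between the plane and `ξ`. (Every 2-plane has an orthonormal basis.) -/
structure IsRiemannianQCManifold (Ω : Set E) (g : E → E →L[ℝ] E →L[ℝ] ℝ) (ξ : E → E) :
    Prop where
  metric : IsRiemannianMetricOn Ω g
  smooth_field : ContDiffOn ℝ ∞ ξ Ω
  unit_field : ∀ p ∈ Ω, g p (ξ p) (ξ p) = 1
  quasiConstant : ∀ p ∈ Ω, ∃ K : ℝ → ℝ, ∀ X Y : E, IsOrthonormalPair g p X Y →
    sectionalCurvature g p X Y = K (angleToPlane g ξ p X Y)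

/-- `a`, `b`, `k` are the curvature functions of the QC-manifold `(Ω, g, ξ)`, free of points of
constant sectional curvature: `𝓡 = a π + b Φ` with `b ≠ 0`, `∇_x ξ = k x` for all `x ⊥ ξ`, and
`k = ξ(a) / (2b)`. -/
structure AreCurvatureFunctions (Ω : Set E) (g : E → E →L[ℝ] E →L[ℝ] ℝ) (ξ : E → E)
    (a b k : E → ℝ) : Prop where
  curvature : ∀ p ∈ Ω, ∀ X Y W U : E,
    curvatureTensor g p X Y W U = a p * tensorPi g p X Y W U + b p * tensorPhi g ξ p X Y W U
  b_ne_zero : ∀ p ∈ Ω, b p ≠ 0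
  umbilical : ∀ p ∈ Ω, ∀ x : E, g p (ξ p) x = 0 → leviCivita g ξ p x = k p • x
  k_eq : ∀ p ∈ Ω, k p = fderiv ℝ a p (ξ p) / (2 * b p)

end RiemannianPatch

/-! ## Minkowski space and canal space-like hypersurfaces -/

/-- The vector space underlying Minkowski space `ℝ^{n+1}_1`. -/
abbrev MinkowskiSpace (n : ℕ) : Type := Fin (n + 1) → ℝ

/-- The Lorentzian inner product, with the coordinate of index `0` as time. -/
def minkowskiForm (n : ℕ) : MinkowskiSpace n →L[ℝ] MinkowskiSpace n →L[ℝ] ℝ :=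
  ∑ i : Fin (n + 1), (if i = 0 then (-1 : ℝ) else 1) •
    (ContinuousLinearMap.proj (R := ℝ) (φ := fun _ : Fin (n + 1) => ℝ) i).smulRight
      (ContinuousLinearMap.proj (R := ℝ) (φ := fun _ : Fin (n + 1) => ℝ) i)

theorem minkowskiForm_apply (n : ℕ) (x y : MinkowskiSpace n) :
    minkowskiForm n x y = -(x 0 * y 0) + ∑ i : Fin n, x i.succ * y i.succ := by
  simp [minkowskiForm, Fin.sum_univ_succ]

/-- The space of the parameters `(s; u¹, …, uⁿ⁻¹)` of an `n`-dimensional hypersurface. -/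
abbrev ParamSpace (n : ℕ) : Type := ℝ × EuclideanSpace ℝ (Fin (n - 1))

/-- The metric that the position vector `Z` induces from Minkowski space. -/
def inducedMetric {n : ℕ} (Z : ParamSpace n → MinkowskiSpace n) (p : ParamSpace n) :
    ParamSpace n →L[ℝ] ParamSpace n →L[ℝ] ℝ :=
  (minkowskiForm n).bilinearComp (fderiv ℝ Z p) (fderiv ℝ Z p)

/-- `Z` is the smooth position vector of a space-like hypersurface with parameters in the open
set `Ω`: the induced metric is positive definite (in particular `Z` is an immersion). -/
structure IsSpaceLikeHypersurface {n : ℕ} (Ω : Set (ParamSpace n))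
    (Z : ParamSpace n → MinkowskiSpace n) : Prop where
  isOpen : IsOpen Ω
  smooth : ContDiffOn ℝ ∞ Z Ω
  spaceLike : ∀ p ∈ Ω, ∀ v : ParamSpace n, v ≠ 0 → 0 < inducedMetric Z p v v

/-- The normal line of the hypersurface `Z` at the point with parameter `p`: all points `y` for
which `y - Z p` is orthogonal to the tangent space. -/
def normalLine {n : ℕ} (Z : ParamSpace n → MinkowskiSpace n) (p : ParamSpace n) :
    Set (MinkowskiSpace n) :=
  {y | ∀ v : ParamSpace n, minkowskiForm n (y - Z p) (fderiv ℝ Z p v) = 0}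

/-- The space-like hypersphere `(y - c)² = -r²`. -/
def hypersphere (n : ℕ) (c : MinkowskiSpace n) (r : ℝ) : Set (MinkowskiSpace n) :=
  {y | minkowskiForm n (y - c) (y - c) = -r ^ 2}

/-- A sphere of codimension two: an `(n-1)`-dimensional cross-section of a space-like hypersphere
with a hyperplane. (A cross-section that is not `(n-1)`-dimensional is empty or one point, and
every hyperplane has an equation `⟨w, y⟩ = d` with `w ≠ 0`, as the form is nondegenerate.) -/
def IsSphereOfCodimTwo (n : ℕ) (S : Set (MinkowskiSpace n)) : Prop :=
  S.Nontrivial ∧ ∃ (c : MinkowskiSpace n) (r : ℝ) (w : MinkowskiSpace n) (d : ℝ),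
    0 < r ∧ w ≠ 0 ∧ S = hypersphere n c r ∩ {y | minkowskiForm n w y = d}

/-- `Z` is the position vector `Z(s; u)`, `(s, u) ∈ Ω`, of a canal space-like hypersurface with
centers `z(s)` and radii `R(s)`: for fixed `s` the points `Z(s; u)` lie on a sphere of codimension
two (the spherical generator), the normals at these points pass through the fixed point `z(s)`,
and `R(s)` is the radius of the hypersphere with center `z(s)` that contains these points. -/
structure IsCanalHypersurface {n : ℕ} (Ω : Set (ParamSpace n))
    (Z : ParamSpace n → MinkowskiSpace n) (z : ℝ → MinkowskiSpace n) (R : ℝ → ℝ) : Prop where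
  hypersurface : IsSpaceLikeHypersurface Ω Z
  generator : ∀ s ∈ Prod.fst '' Ω, ∃ S : Set (MinkowskiSpace n), IsSphereOfCodimTwo n S ∧
    ∀ u, (s, u) ∈ Ω → Z (s, u) ∈ S
  smooth_center : ContDiffOn ℝ ∞ z (Prod.fst '' Ω)
  normals : ∀ s u, (s, u) ∈ Ω → z s ∈ normalLine Z (s, u)
  radius_pos : ∀ s ∈ Prod.fst '' Ω, 0 < R s
  mem_hypersphere : ∀ s u, (s, u) ∈ Ω → Z (s, u) ∈ hypersphere n (z s) (R s)

/-- Hyperbolic type: the curve of centers is space-like. -/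
def IsHyperbolicType {n : ℕ} (Ω : Set (ParamSpace n)) (z : ℝ → MinkowskiSpace n) : Prop :=
  ∀ s ∈ Prod.fst '' Ω, 0 < minkowskiForm n (deriv z s) (deriv z s)

/-- The derivative of the radius with respect to the natural parameter (arc length) of the curve
of centers; it is `R'(s)` if `z` is parameterized by its natural parameter. -/
def radiusDeriv {n : ℕ} (z : ℝ → MinkowskiSpace n) (R : ℝ → ℝ) (s : ℝ) : ℝ :=
  deriv R s / Real.sqrt (minkowskiForm n (deriv z s) (deriv z s))

/-- The unit normal `N = -(Z - z) / R`. -/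
def canalNormal {n : ℕ} (Z : ParamSpace n → MinkowskiSpace n) (z : ℝ → MinkowskiSpace n)
    (R : ℝ → ℝ) (p : ParamSpace n) : MinkowskiSpace n :=
  -((R p.1)⁻¹ • (Z p - z p.1))

/-- The tangential vector `z' - R' N`. -/
def canalDirection {n : ℕ} (Z : ParamSpace n → MinkowskiSpace n) (z : ℝ → MinkowskiSpace n)
    (R : ℝ → ℝ) (p : ParamSpace n) : MinkowskiSpace n :=
  deriv z p.1 - deriv R p.1 • canalNormal Z z R p

/-- `ξ` is the vector field on the parameter domain that represents the tangent vector field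
`(z' - R' N) / √((z' - R' N)²)` of the canal hypersurface. -/
def IsCanalStructuralField {n : ℕ} (Ω : Set (ParamSpace n))
    (Z : ParamSpace n → MinkowskiSpace n) (z : ℝ → MinkowskiSpace n) (R : ℝ → ℝ)
    (ξ : ParamSpace n → ParamSpace n) : Prop :=
  ∀ p ∈ Ω, 0 < minkowskiForm n (canalDirection Z z R p) (canalDirection Z z R p) ∧
    fderiv ℝ Z p (ξ p) =
      (Real.sqrt (minkowskiForm n (canalDirection Z z R p) (canalDirection Z z R p)))⁻¹ •
        canalDirection Z z R p

end

/-! Everything follows from the shape of the second fundamental form. Since `R N = z - Z`,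
differentiation gives `R dN = (z' - R' N) ds - dZ`. With `λ = |z' - R' N|`, the Weingarten formula
turns this into `R II = g - λ ds ⊗ η`. As `II` is symmetric, `ds` must be a multiple of `η`, namely
`ds = ξ(s) η`, so `II = (g - λ ξ(s) η ⊗ η) / R`. The normal is time-like, so the Gauss equation has
the opposite sign to the Euclidean one. It yields `𝓡 = a π + b Φ` with `a = -1/R²` and `b = λ
ξ(s)/R²`; here `ξ(s) ≠ 0` because `ds ≠ 0`.

If `x ⊥ ξ`, then `ds(x) = 0`, so only `N` varies in `ξ = (z' - R' N)/λ`, and `dN(x) = -dZ(x)/R`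
gives `k = R'/(R λ)`. From `N² = -1` follows `⟨N, z'⟩ = -R'`, hence `λ² = z'² + R'²`, and `a + k² =
-z'²/(R² λ²)`.

The lemmas that carry this are `curvatureTensor_firstForm`, `radius_smul_fderiv_normal`, `fst_eq`,
`curvatureTensor_eq` and `leviCivita_field`. -/

section HypersurfaceWithNormal

theorem two_le_infty : (2 : WithTop ℕ∞) ≤ ∞ := by
  exact WithTop.coe_le_coe.2 (le_top : (2 : ℕ∞) ≤ ⊤)

/-! ### Gauss and Weingarten formulas and the Gauss equation for a time-like unit normal. -/

variable {E F : Type*} [NormedAddCommGroup E] [NormedSpace ℝ E] [NormedAddCommGroup F]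
  [NormedSpace ℝ F]

/-- The pullback of the bilinear form `B` by the derivative of `Z`. -/
noncomputable def firstForm (B : F →L[ℝ] F →L[ℝ] ℝ) (Z : E → F) (p : E) : E →L[ℝ] E →L[ℝ] ℝ :=
  B.bilinearComp (fderiv ℝ Z p) (fderiv ℝ Z p)

/-- The second fundamental form of `Z` with respect to the normal field `N`. -/
noncomputable def secondForm (B : F →L[ℝ] F →L[ℝ] ℝ) (Z N : E → F) (p X Y : E) : ℝ :=
  B (fderiv ℝ (fderiv ℝ Z) p X Y) (N p)

/-- `Z` is a smooth immersed space-like hypersurface of `(F, B)` with the smooth time-like unit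
normal field `N`. -/
structure IsSpaceLikeWithNormal (B : F →L[ℝ] F →L[ℝ] ℝ) (Ω : Set E) (Z N : E → F) : Prop where
  isOpen : IsOpen Ω
  smooth : ContDiffOn ℝ ∞ Z Ω
  smooth_normal : ContDiffOn ℝ ∞ N Ω
  finrank_eq : Module.finrank ℝ F = Module.finrank ℝ E + 1
  symm : ∀ x y : F, B x y = B y x
  spaceLike : ∀ p ∈ Ω, ∀ v : E, v ≠ 0 → 0 < B (fderiv ℝ Z p v) (fderiv ℝ Z p v)
  normal_sq : ∀ p ∈ Ω, B (N p) (N p) = -1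
  normal_orth : ∀ p ∈ Ω, ∀ v : E, B (N p) (fderiv ℝ Z p v) = 0

@[simp]
theorem firstForm_apply (B : F →L[ℝ] F →L[ℝ] ℝ) (Z : E → F) (p X Y : E) :
    firstForm B Z p X Y = B (fderiv ℝ Z p X) (fderiv ℝ Z p Y) := rfl

namespace IsSpaceLikeWithNormal

variable {B : F →L[ℝ] F →L[ℝ] ℝ} {Ω : Set E} {Z N : E → F} {p : E}

theorem contDiffAt (h : IsSpaceLikeWithNormal B Ω Z N) (hp : p ∈ Ω) : ContDiffAt ℝ ∞ Z p :=
  h.smooth.contDiffAt (h.isOpen.mem_nhds hp)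

theorem contDiffAt_fderiv (h : IsSpaceLikeWithNormal B Ω Z N) (hp : p ∈ Ω) :
    ContDiffAt ℝ ∞ (fderiv ℝ Z) p :=
  (h.contDiffAt hp).fderiv_right (by simp)

theorem contDiffAt_fderiv_fderiv (h : IsSpaceLikeWithNormal B Ω Z N) (hp : p ∈ Ω) :
    ContDiffAt ℝ ∞ (fderiv ℝ (fderiv ℝ Z)) p :=
  (h.contDiffAt_fderiv hp).fderiv_right (by simp)

theorem contDiffAt_normal (h : IsSpaceLikeWithNormal B Ω Z N) (hp : p ∈ Ω) : ContDiffAt ℝ ∞ N p :=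
  h.smooth_normal.contDiffAt (h.isOpen.mem_nhds hp)

theorem isSymmSndFDerivAt (h : IsSpaceLikeWithNormal B Ω Z N) (hp : p ∈ Ω) :
    IsSymmSndFDerivAt ℝ Z p :=
  (h.contDiffAt hp).isSymmSndFDerivAt (by simpa using two_le_infty)

theorem eq_zero_of_firstForm (h : IsSpaceLikeWithNormal B Ω Z N) (hp : p ∈ Ω) {v : E}
    (hv : firstForm B Z p v v = 0) : v = 0 := by
  by_contra hne
  exact (h.spaceLike p hp v hne).ne' hv

theorem firstForm_ext (h : IsSpaceLikeWithNormal B Ω Z N) (hp : p ∈ Ω) {v w : E}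
    (hvw : ∀ U, firstForm B Z p v U = firstForm B Z p w U) : v = w := by
  rw [← sub_eq_zero]
  refine h.eq_zero_of_firstForm hp ?_
  have : firstForm B Z p (v - w) = 0 := by ext U; simpa [sub_eq_zero] using hvw U
  rw [this, zero_apply]

theorem firstForm_symm (h : IsSpaceLikeWithNormal B Ω Z N) (p X Y : E) :
    firstForm B Z p X Y = firstForm B Z p Y X := h.symm _ _

theorem fderiv_fderiv_apply (h : IsSpaceLikeWithNormal B Ω Z N) (hp : p ∈ Ω) {V : E → E}
    (hV : DifferentiableAt ℝ V p) (X : E) :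
    fderiv ℝ (fun q => fderiv ℝ Z q (V q)) p X
      = fderiv ℝ Z p (fderiv ℝ V p X) + fderiv ℝ (fderiv ℝ Z) p X (V p) := by
  have h1 := ((h.contDiffAt_fderiv hp).differentiableAt (by simp)).hasFDerivAt
  rw [(h1.clm_apply hV.hasFDerivAt).fderiv]
  simp

theorem fderiv_bilin {f₁ f₂ : E → F} (h₁ : DifferentiableAt ℝ f₁ p) (h₂ : DifferentiableAt ℝ f₂ p)
    (X : E) :
    fderiv ℝ (fun q => B (f₁ q) (f₂ q)) p X
      = B (fderiv ℝ f₁ p X) (f₂ p) + B (f₁ p) (fderiv ℝ f₂ p X) := by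
  have := (B.hasFDerivAt.comp p h₁.hasFDerivAt).clm_apply h₂.hasFDerivAt
  rw [show (fun q => B (f₁ q) (f₂ q)) = fun q => (B ∘ f₁) q (f₂ q) from rfl, this.fderiv]
  simp [add_comm]

theorem leviCivita_const (g : E → E →L[ℝ] E →L[ℝ] ℝ) (W p X : E) :
    leviCivita g (fun _ => W) p X = christoffel g p X W := by
  simp [leviCivita]

theorem secondForm_symm (h : IsSpaceLikeWithNormal B Ω Z N) (hp : p ∈ Ω) (X Y : E) :
    secondForm B Z N p X Y = secondForm B Z N p Y X := by
  rw [secondForm, secondForm, (h.isSymmSndFDerivAt hp).eq X Y]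

/-- The Weingarten formula. -/
theorem secondForm_eq (h : IsSpaceLikeWithNormal B Ω Z N) (hp : p ∈ Ω) (X Y : E) :
    secondForm B Z N p X Y = -B (fderiv ℝ N p X) (fderiv ℝ Z p Y) := by
  have h2 := (h.contDiffAt_fderiv hp).differentiableAt (by simp)
  have h3 : DifferentiableAt ℝ (fun q => fderiv ℝ Z q Y) p :=
    h2.clm_apply (differentiableAt_const Y)
  have h4 := (h.contDiffAt_normal hp).differentiableAt (by simp)
  have h5 := fderiv_bilin (B := B) h4 h3 X
  have h6 : (fun q => B (N q) (fderiv ℝ Z q Y)) =ᶠ[nhds p] fun _ => 0 := by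
    filter_upwards [h.isOpen.mem_nhds hp] with q hq using h.normal_orth q hq Y
  rw [h6.fderiv_eq, h.fderiv_fderiv_apply hp (differentiableAt_const Y)] at h5
  simp only [fderiv_fun_const, Pi.zero_apply, zero_apply, map_zero,
    zero_add] at h5
  rw [secondForm, h.symm]
  linarith

variable [FiniteDimensional ℝ E]

theorem contDiffOn_firstForm (h : IsSpaceLikeWithNormal B Ω Z N) :
    ContDiffOn ℝ ∞ (firstForm B Z) Ω := by
  rw [contDiffOn_clm_apply]
  intro X
  rw [contDiffOn_clm_apply]
  intro Y p hp
  have h1 := h.contDiffAt_fderiv hp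
  exact ((contDiffAt_const.clm_apply (h1.clm_apply contDiffAt_const)).clm_apply
    (h1.clm_apply contDiffAt_const)).contDiffWithinAt

theorem isRiemannianMetricOn (h : IsSpaceLikeWithNormal B Ω Z N) :
    IsRiemannianMetricOn Ω (firstForm B Z) where
  isOpen := h.isOpen
  smooth := h.contDiffOn_firstForm
  symm p _ X Y := h.firstForm_symm p X Y
  pos := h.spaceLike

/-- Positive definiteness gives injectivity, and `E` and its dual have equal dimension. Without
invertibility, `inverse` would take the default value `0` and `christoffel` would be meaningless. -/
theorem isInvertible_firstForm (h : IsSpaceLikeWithNormal B Ω Z N) (hp : p ∈ Ω) :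
    (firstForm B Z p).IsInvertible := by
  have hinj : Function.Injective (firstForm B Z p : E →ₗ[ℝ] E →L[ℝ] ℝ) := by
    rw [injective_iff_map_eq_zero]
    intro v hv
    refine h.eq_zero_of_firstForm hp ?_
    have : firstForm B Z p v = 0 := hv
    rw [this]; rfl
  have hdim : Module.finrank ℝ E = Module.finrank ℝ (E →L[ℝ] ℝ) := by
    rw [← (LinearMap.toContinuousLinearMap (𝕜 := ℝ) (E := E) (F' := ℝ)).finrank_eq]
    exact (Subspace.dual_finrank_eq (K := ℝ) (V := E)).symm
  let e := (LinearEquiv.ofInjectiveOfFinrankEq _ hinj hdim).toContinuousLinearEquiv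
  refine ⟨e, ?_⟩
  ext v
  rfl

theorem firstForm_inverse (h : IsSpaceLikeWithNormal B Ω Z N) (hp : p ∈ Ω) (L : E →L[ℝ] ℝ) :
    firstForm B Z p ((firstForm B Z p).inverse L) = L :=
  (h.isInvertible_firstForm hp).self_apply_inverse L

theorem contDiffAt_inverse_firstForm (h : IsSpaceLikeWithNormal B Ω Z N) (hp : p ∈ Ω)
    {L : E → E →L[ℝ] ℝ} (hL : ContDiffAt ℝ ∞ L p) :
    ContDiffAt ℝ ∞ (fun q => (firstForm B Z q).inverse (L q)) p := by
  have hg : ContDiffAt ℝ ∞ (firstForm B Z) p :=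
    h.contDiffOn_firstForm.contDiffAt (h.isOpen.mem_nhds hp)
  have hi : ContDiffAt ℝ ∞ (fun q => (firstForm B Z q).inverse) p :=
    ((h.isInvertible_firstForm hp).contDiffAt_map_inverse).comp p hg
  exact hi.clm_apply hL

/-- Every vector is the sum of its tangential and normal parts. -/
theorem exists_tangent_decomposition (h : IsSpaceLikeWithNormal B Ω Z N) (hp : p ∈ Ω) (V : F) :
    ∃ v : E, V = fderiv ℝ Z p v - B V (N p) • N p := by
  have : FiniteDimensional ℝ F :=
    Module.finite_of_finrank_pos (by rw [h.finrank_eq]; exact Nat.succ_pos _)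
  -- `T` is the tangent map extended by the normal line. Pairing with `N` recovers the normal
  -- coefficient up to sign, so `T` is injective, hence surjective by dimension.
  let T : (E × ℝ) →ₗ[ℝ] F :=
    (fderiv ℝ Z p : E →ₗ[ℝ] F).coprod (LinearMap.toSpanSingleton ℝ F (N p))
  have hT : ∀ x, T x = fderiv ℝ Z p x.1 + x.2 • N p := fun x => by simp [T]
  have hN : ∀ x, B (T x) (N p) = -x.2 := fun x => by
    rw [hT, map_add, map_smul, add_apply, h.symm, h.normal_orth p hp,
      smul_apply, h.normal_sq p hp]
    simp
  have hinj : Function.Injective T := by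
    rw [injective_iff_map_eq_zero]
    rintro ⟨v, t⟩ hx
    have ht : t = 0 := by simpa [hx] using (hN (v, t)).symm
    have hv : fderiv ℝ Z p v = 0 := by simpa [hT, ht] using hx
    have : v = 0 := h.eq_zero_of_firstForm hp (by simp [hv])
    simp [this, ht]
  have hdim : Module.finrank ℝ (E × ℝ) = Module.finrank ℝ F := by
    simp [h.finrank_eq]
  obtain ⟨⟨v, t⟩, hx⟩ := (LinearMap.injective_iff_surjective_of_finrank_eq_finrank hdim).1 hinj V
  refine ⟨v, ?_⟩
  rw [← hx, hN, hT]
  simp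

/-- The tangent vector whose scalar products with tangent vectors are those of `V`. -/
theorem fderiv_eq_of_firstForm_eq (h : IsSpaceLikeWithNormal B Ω Z N) (hp : p ∈ Ω) {V : F} {v : E}
    (hv : ∀ U, firstForm B Z p v U = B V (fderiv ℝ Z p U)) :
    fderiv ℝ Z p v = V + B V (N p) • N p := by
  obtain ⟨w, hw⟩ := h.exists_tangent_decomposition hp V
  have : v = w := h.firstForm_ext hp fun U => by
    rw [hv, hw]
    simp [h.normal_orth p hp]
  rw [this]
  nth_rw 1 [hw]
  simp

theorem fderiv_firstForm (h : IsSpaceLikeWithNormal B Ω Z N) (hp : p ∈ Ω) (X Y W : E) :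
    fderiv ℝ (firstForm B Z) p X Y W
      = B (fderiv ℝ (fderiv ℝ Z) p X Y) (fderiv ℝ Z p W)
        + B (fderiv ℝ Z p Y) (fderiv ℝ (fderiv ℝ Z) p X W) := by
  have hg : HasFDerivAt (firstForm B Z) _ p :=
    ((h.contDiffOn_firstForm.contDiffAt (h.isOpen.mem_nhds hp)).differentiableAt
      (by simp)).hasFDerivAt
  have h1 := ((hg.clm_apply (hasFDerivAt_const Y p)).clm_apply (hasFDerivAt_const W p)).fderiv
  have h2 := (h.contDiffAt_fderiv hp).differentiableAt (by simp)
  have h3 : ∀ V : E, DifferentiableAt ℝ (fun q => fderiv ℝ Z q V) p :=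
    fun V => h2.clm_apply (differentiableAt_const V)
  have h4 : ∀ V : E, fderiv ℝ (fun q => fderiv ℝ Z q V) p X = fderiv ℝ (fderiv ℝ Z) p X V :=
    fun V => by
      rw [h.fderiv_fderiv_apply hp (differentiableAt_const V)]
      simp
  have h5 := fderiv_bilin (B := B) (h3 Y) (h3 W) X
  rw [h4, h4] at h5
  rw [← h5]
  have h6 := congrArg (fun L : E →L[ℝ] ℝ => L X) h1
  simpa using h6.symm

/-- Of the six terms from the product rule, four cancel by symmetry of the second derivative of `Z`
and the other two coincide. -/
theorem christoffelForm_firstForm (h : IsSpaceLikeWithNormal B Ω Z N) (hp : p ∈ Ω) (X Y W : E) :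
    christoffelForm (firstForm B Z) p X Y W
      = B (fderiv ℝ (fderiv ℝ Z) p X Y) (fderiv ℝ Z p W) := by
  have hs := h.isSymmSndFDerivAt hp
  rw [christoffelForm_apply, h.fderiv_firstForm hp, h.fderiv_firstForm hp, h.fderiv_firstForm hp,
    hs.eq Y X, hs.eq W X, hs.eq W Y, h.symm (fderiv ℝ Z p Y), h.symm (fderiv ℝ Z p X)]
  ring

theorem firstForm_christoffel (h : IsSpaceLikeWithNormal B Ω Z N) (hp : p ∈ Ω) (X Y W : E) :
    firstForm B Z p (christoffel (firstForm B Z) p X Y) W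
      = B (fderiv ℝ (fderiv ℝ Z) p X Y) (fderiv ℝ Z p W) := by
  rw [christoffel, h.firstForm_inverse hp, h.christoffelForm_firstForm hp]

/-- The covariant derivative is the tangential part of the derivative in the ambient space. -/
theorem firstForm_leviCivita (h : IsSpaceLikeWithNormal B Ω Z N) (hp : p ∈ Ω) {V : E → E}
    (hV : DifferentiableAt ℝ V p) (X U : E) :
    firstForm B Z p (leviCivita (firstForm B Z) V p X) U
      = B (fderiv ℝ (fun q => fderiv ℝ Z q (V q)) p X) (fderiv ℝ Z p U) := by
  rw [leviCivita, map_add, add_apply, h.firstForm_christoffel hp,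
    h.fderiv_fderiv_apply hp hV, map_add, add_apply, firstForm_apply]

theorem contDiffAt_christoffel (h : IsSpaceLikeWithNormal B Ω Z N) (hp : p ∈ Ω) (X Y : E) :
    ContDiffAt ℝ ∞ (fun q => christoffel (firstForm B Z) q X Y) p := by
  have hL : ContDiffOn ℝ ∞ (fun q => christoffelForm (firstForm B Z) q X Y) Ω := by
    rw [contDiffOn_clm_apply]
    intro W
    have : ContDiffOn ℝ ∞ (fun q => B (fderiv ℝ (fderiv ℝ Z) q X Y) (fderiv ℝ Z q W)) Ω := by
      intro q hq
      have h1 := h.contDiffAt_fderiv hq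
      have h2 := h.contDiffAt_fderiv_fderiv hq
      exact ((contDiffAt_const.clm_apply ((h2.clm_apply contDiffAt_const).clm_apply
        contDiffAt_const)).clm_apply (h1.clm_apply contDiffAt_const)).contDiffWithinAt
    exact this.congr fun q hq => h.christoffelForm_firstForm hq X Y W
  exact h.contDiffAt_inverse_firstForm hp (hL.contDiffAt (h.isOpen.mem_nhds hp))

/-- The Gauss formula. -/
theorem fderiv_christoffel (h : IsSpaceLikeWithNormal B Ω Z N) (hp : p ∈ Ω) (X Y : E) :
    fderiv ℝ Z p (christoffel (firstForm B Z) p X Y)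
      = fderiv ℝ (fderiv ℝ Z) p X Y + secondForm B Z N p X Y • N p :=
  h.fderiv_eq_of_firstForm_eq hp fun U => h.firstForm_christoffel hp X Y U

/-- Differentiate the Gauss formula along `X` and pair with `dZ U`. The term in which `II(Y, W)` is
differentiated is normal and drops out; the Weingarten formula evaluates the term with `dN`. The
third derivatives of `Z` will cancel on antisymmetrizing in `X`, `Y`. -/
theorem firstForm_leviCivita_leviCivita (h : IsSpaceLikeWithNormal B Ω Z N) (hp : p ∈ Ω)
    (X Y W U : E) :
    firstForm B Z p (leviCivita (firstForm B Z)
        (fun q => leviCivita (firstForm B Z) (fun _ => W) q Y) p X) U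
      = B (fderiv ℝ (fderiv ℝ (fderiv ℝ Z)) p X Y W) (fderiv ℝ Z p U)
        - secondForm B Z N p Y W * secondForm B Z N p X U := by
  simp_rw [leviCivita_const]
  rw [h.firstForm_leviCivita hp ((h.contDiffAt_christoffel hp Y W).differentiableAt (by simp))]
  have h1 : (fun q => fderiv ℝ Z q (christoffel (firstForm B Z) q Y W)) =ᶠ[nhds p]
      fun q => fderiv ℝ (fderiv ℝ Z) q Y W + secondForm B Z N q Y W • N q := by
    filter_upwards [h.isOpen.mem_nhds hp] with q hq using h.fderiv_christoffel hq Y W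
  have h2 := ((h.contDiffAt_fderiv_fderiv hp).differentiableAt (by simp)).hasFDerivAt
  have h3 := (h2.clm_apply (hasFDerivAt_const Y p)).clm_apply (hasFDerivAt_const W p)
  have h4 := ((h.contDiffAt_normal hp).differentiableAt (by simp)).hasFDerivAt
  have h5 : HasFDerivAt (fun q => secondForm B Z N q Y W) _ p :=
    (B.hasFDerivAt.comp p h3).clm_apply h4
  rw [h1.fderiv_eq, (h3.fun_add (h5.fun_smul h4)).fderiv, h.secondForm_eq hp X U]
  simp [h.normal_orth p hp]

/-- The Gauss equation. -/
theorem curvatureTensor_firstForm (h : IsSpaceLikeWithNormal B Ω Z N) (hp : p ∈ Ω)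
    (X Y W U : E) :
    curvatureTensor (firstForm B Z) p X Y W U
      = secondForm B Z N p X W * secondForm B Z N p Y U
        - secondForm B Z N p Y W * secondForm B Z N p X U := by
  have hs : IsSymmSndFDerivAt ℝ (fderiv ℝ Z) p :=
    (h.contDiffAt_fderiv hp).isSymmSndFDerivAt (by simpa using two_le_infty)
  rw [curvatureTensor, curvatureOperator, map_sub, sub_apply,
    h.firstForm_leviCivita_leviCivita hp, h.firstForm_leviCivita_leviCivita hp, hs.eq X Y]
  ring

end IsSpaceLikeWithNormal

end HypersurfaceWithNormal

theorem minkowskiForm_comm (n : ℕ) (x y : MinkowskiSpace n) :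
    minkowskiForm n x y = minkowskiForm n y x := by
  simp only [minkowskiForm_apply, mul_comm]

/-! ### Canal hypersurfaces: smoothness of the radius, derivative of the normal, length of `z' - R'
N`. -/

namespace IsCanalHypersurface

variable {n : ℕ} {Ω : Set (ParamSpace n)} {Z : ParamSpace n → MinkowskiSpace n}
  {z : ℝ → MinkowskiSpace n} {R : ℝ → ℝ} {p : ParamSpace n} {s : ℝ}

theorem isOpen_image_fst (h : IsCanalHypersurface Ω Z z R) : IsOpen (Prod.fst '' Ω) :=
  isOpenMap_fst _ h.hypersurface.isOpen

theorem contDiffAt_center (h : IsCanalHypersurface Ω Z z R) (hs : s ∈ Prod.fst '' Ω) :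
    ContDiffAt ℝ ∞ z s :=
  h.smooth_center.contDiffAt (h.isOpen_image_fst.mem_nhds hs)

/-- Along a slice of fixed `u`, `R` is the square root of the smooth positive function `-(Z - z)²`,
so its smoothness need not be assumed. -/
theorem contDiffAt_radius (h : IsCanalHypersurface Ω Z z R) (hs : s ∈ Prod.fst '' Ω) :
    ContDiffAt ℝ ∞ R s := by
  obtain ⟨⟨s, u⟩, hp, rfl⟩ := id hs
  have hopen := h.hypersurface.isOpen
  have hc : ContDiffAt ℝ ∞ (fun t : ℝ => ((t, u) : ParamSpace n)) s :=
    contDiffAt_id.prodMk contDiffAt_const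
  have hZ : ContDiffAt ℝ ∞ (fun t => Z (t, u) - z t) s :=
    ((h.hypersurface.smooth.contDiffAt (hopen.mem_nhds hp)).comp s hc).sub
      (h.contDiffAt_center hs)
  have hev : ∀ᶠ t in nhds s, (t, u) ∈ Ω := hc.continuousAt (hopen.mem_nhds hp)
  have hsq : ∀ t, (t, u) ∈ Ω →
      -minkowskiForm n (Z (t, u) - z t) (Z (t, u) - z t) = R t ^ 2 := fun t ht => by
    have : minkowskiForm n (Z (t, u) - z t) (Z (t, u) - z t) = -R t ^ 2 :=
      h.mem_hypersphere t u ht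
    rw [this, neg_neg]
  have hpos : ∀ t, (t, u) ∈ Ω → 0 < R t := fun t ht => h.radius_pos t ⟨_, ht, rfl⟩
  have hR : R =ᶠ[nhds s]
      fun t => Real.sqrt (-minkowskiForm n (Z (t, u) - z t) (Z (t, u) - z t)) := by
    filter_upwards [hev] with t ht
    rw [hsq t ht, Real.sqrt_sq (hpos t ht).le]
  refine ContDiffAt.congr_of_eventuallyEq ?_ hR
  refine ((contDiffAt_const.clm_apply hZ).clm_apply hZ).neg.sqrt ?_
  rw [hsq s hp]
  exact (pow_pos (hpos s hp) 2).ne'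

theorem radius_pos_of_mem (h : IsCanalHypersurface Ω Z z R) (hp : p ∈ Ω) : 0 < R p.1 :=
  h.radius_pos _ ⟨p, hp, rfl⟩

theorem isSpaceLikeWithNormal (h : IsCanalHypersurface Ω Z z R) (hn : 1 ≤ n) :
    IsSpaceLikeWithNormal (minkowskiForm n) Ω Z (canalNormal Z z R) where
  isOpen := h.hypersurface.isOpen
  smooth := h.hypersurface.smooth
  smooth_normal p hp := by
    have hs : p.1 ∈ Prod.fst '' Ω := ⟨p, hp, rfl⟩
    have hR : ContDiffAt ℝ ∞ (fun q : ParamSpace n => R q.1) p :=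
      (h.contDiffAt_radius hs).comp p contDiffAt_fst
    have hz : ContDiffAt ℝ ∞ (fun q : ParamSpace n => z q.1) p :=
      (h.contDiffAt_center hs).comp p contDiffAt_fst
    have hZ := h.hypersurface.smooth.contDiffAt (h.hypersurface.isOpen.mem_nhds hp)
    exact ((hR.inv (h.radius_pos_of_mem hp).ne').smul (hZ.sub hz)).neg.contDiffWithinAt
  finrank_eq := by
    simp
    -- The truncated subtraction in `1 + (n - 1) + 1 = n + 1` is where `1 ≤ n` enters.
    omega
  symm := minkowskiForm_comm n
  spaceLike := h.hypersurface.spaceLike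
  normal_sq p hp := by
    have hR := (h.radius_pos_of_mem hp).ne'
    have : minkowskiForm n (Z p - z p.1) (Z p - z p.1) = -R p.1 ^ 2 := h.mem_hypersphere p.1 p.2 hp
    simp only [canalNormal, map_neg, map_smul, neg_apply, smul_apply, smul_eq_mul, this]
    field_simp
  normal_orth p hp v := by
    have : minkowskiForm n (z p.1 - Z p) (fderiv ℝ Z p v) = 0 := h.normals p.1 p.2 hp v
    rw [canalNormal, ← smul_neg, neg_sub, map_smul, smul_apply, this, smul_zero]

theorem hasFDerivAt_center (h : IsCanalHypersurface Ω Z z R) (hp : p ∈ Ω) :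
    HasFDerivAt (fun q : ParamSpace n => z q.1)
      ((ContinuousLinearMap.toSpanSingleton ℝ (deriv z p.1)).comp
        (ContinuousLinearMap.fst ℝ ℝ (EuclideanSpace ℝ (Fin (n - 1))))) p :=
  (((h.contDiffAt_center ⟨p, hp, rfl⟩).differentiableAt
    (by simp)).hasDerivAt.hasFDerivAt).comp p hasFDerivAt_fst

theorem hasFDerivAt_radius (h : IsCanalHypersurface Ω Z z R) (hp : p ∈ Ω) :
    HasFDerivAt (fun q : ParamSpace n => R q.1)
      (deriv R p.1 • ContinuousLinearMap.fst ℝ ℝ (EuclideanSpace ℝ (Fin (n - 1)))) p :=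
  ((h.contDiffAt_radius ⟨p, hp, rfl⟩).differentiableAt
    (by simp)).hasDerivAt.comp_hasFDerivAt p hasFDerivAt_fst

/-- This is the derivative of `R N = z - Z`, with the two terms in `ds` collected. -/
theorem radius_smul_fderiv_normal (h : IsCanalHypersurface Ω Z z R) (hn : 1 ≤ n) (hp : p ∈ Ω)
    (v : ParamSpace n) :
    R p.1 • fderiv ℝ (canalNormal Z z R) p v
      = v.1 • canalDirection Z z R p - fderiv ℝ Z p v := by
  have hN := (((h.isSpaceLikeWithNormal hn).contDiffAt_normal hp).differentiableAt
    (by simp)).hasFDerivAt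
  have hZ := (((h.isSpaceLikeWithNormal hn).contDiffAt hp).differentiableAt (by simp)).hasFDerivAt
  have h1 := (h.hasFDerivAt_radius hp).fun_smul hN
  have h2 := (h.hasFDerivAt_center hp).fun_sub hZ
  have h3 : (fun q : ParamSpace n => R q.1 • canalNormal Z z R q) =ᶠ[nhds p]
      fun q => z q.1 - Z q := by
    filter_upwards [h.hypersurface.isOpen.mem_nhds hp] with q hq
    rw [canalNormal, smul_neg, smul_inv_smul₀ (h.radius_pos_of_mem hq).ne', neg_sub]
  have h4 := congrArg (fun L => L v) (h1.unique (h2.congr_of_eventuallyEq h3))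
  simp only [add_apply, smul_apply, sub_apply, ContinuousLinearMap.smulRight_apply,
    ContinuousLinearMap.comp_apply, ContinuousLinearMap.toSpanSingleton_apply,
    ContinuousLinearMap.coe_fst', smul_eq_mul] at h4
  rw [canalDirection, eq_sub_of_add_eq h4, smul_sub, smul_smul, mul_comm v.1]
  abel

/-- `N² = -1` makes `dN` orthogonal to `N`. Pairing `radius_smul_fderiv_normal` with `N` in the
direction `(1, 0)`, where `ds = 1`, then leaves `⟨N, z' - R' N⟩ = 0`. -/
theorem minkowskiForm_normal_deriv (h : IsCanalHypersurface Ω Z z R) (hn : 1 ≤ n) (hp : p ∈ Ω) :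
    minkowskiForm n (canalNormal Z z R p) (deriv z p.1) = -deriv R p.1 := by
  have hH := h.isSpaceLikeWithNormal hn
  have hN := (hH.contDiffAt_normal hp).differentiableAt (by simp)
  have h1 := IsSpaceLikeWithNormal.fderiv_bilin (B := minkowskiForm n) hN hN (1, 0)
  have h2 : (fun q => minkowskiForm n (canalNormal Z z R q) (canalNormal Z z R q)) =ᶠ[nhds p]
      fun _ => -1 := by
    filter_upwards [h.hypersurface.isOpen.mem_nhds hp] with q hq using hH.normal_sq q hq
  rw [h2.fderiv_eq, minkowskiForm_comm n (fderiv ℝ _ p _)] at h1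
  simp only [fderiv_fun_const, Pi.zero_apply, zero_apply] at h1
  have h3 := congrArg (minkowskiForm n (canalNormal Z z R p))
    (h.radius_smul_fderiv_normal hn hp (1, 0))
  simp only [canalDirection, map_smul, map_sub, hH.normal_orth p hp, hH.normal_sq p hp,
    smul_eq_mul] at h3
  have h4 : minkowskiForm n (canalNormal Z z R p)
    (fderiv ℝ (canalNormal Z z R) p (1, 0)) = 0 := by linarith
  rw [h4] at h3
  linarith

theorem minkowskiForm_direction_normal (h : IsCanalHypersurface Ω Z z R) (hn : 1 ≤ n)
    (hp : p ∈ Ω) :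
    minkowskiForm n (canalDirection Z z R p) (canalNormal Z z R p) = 0 := by
  rw [minkowskiForm_comm, canalDirection, map_sub, map_smul, h.minkowskiForm_normal_deriv hn hp,
    (h.isSpaceLikeWithNormal hn).normal_sq p hp]
  simp

theorem minkowskiForm_direction_direction (h : IsCanalHypersurface Ω Z z R) (hn : 1 ≤ n)
    (hp : p ∈ Ω) :
    minkowskiForm n (canalDirection Z z R p) (canalDirection Z z R p)
      = minkowskiForm n (deriv z p.1) (deriv z p.1) + deriv R p.1 ^ 2 := by
  have h1 := h.minkowskiForm_direction_normal hn hp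
  have h2 := h.minkowskiForm_normal_deriv hn hp
  rw [minkowskiForm_comm] at h2
  nth_rw 2 [canalDirection]
  rw [map_sub, map_smul, h1, canalDirection, map_sub, map_smul, sub_apply, smul_apply,
    h.minkowskiForm_normal_deriv hn hp]
  simp only [smul_eq_mul]
  ring

end IsCanalHypersurface

/-- The length of `z' - R' N` as a function of `s`. -/
noncomputable def canalSpeed {n : ℕ} (z : ℝ → MinkowskiSpace n) (R : ℝ → ℝ) (s : ℝ) : ℝ :=
  Real.sqrt (minkowskiForm n (deriv z s) (deriv z s) + deriv R s ^ 2)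

/-- The unit vector field along the canal hypersurface in the direction of `z' - R' N`. -/
noncomputable def canalUnitDirection {n : ℕ} (Z : ParamSpace n → MinkowskiSpace n)
    (z : ℝ → MinkowskiSpace n) (R : ℝ → ℝ) (p : ParamSpace n) : MinkowskiSpace n :=
  (canalSpeed z R p.1)⁻¹ • canalDirection Z z R p

/-- The structural field of a canal hypersurface of hyperbolic type in the parameter domain. -/
noncomputable def canalField {n : ℕ} (Z : ParamSpace n → MinkowskiSpace n)
    (z : ℝ → MinkowskiSpace n) (R : ℝ → ℝ) (p : ParamSpace n) : ParamSpace n :=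
  (firstForm (minkowskiForm n) Z p).inverse
    ((minkowskiForm n (canalUnitDirection Z z R p)).comp (fderiv ℝ Z p))

/-! ### The structural field, the second fundamental form and the curvature functions. -/

namespace IsCanalHypersurface

variable {n : ℕ} {Ω : Set (ParamSpace n)} {Z : ParamSpace n → MinkowskiSpace n}
  {z : ℝ → MinkowskiSpace n} {R : ℝ → ℝ} {p : ParamSpace n} {s : ℝ}

theorem contDiffAt_deriv_center (h : IsCanalHypersurface Ω Z z R) (hs : s ∈ Prod.fst '' Ω) :
    ContDiffAt ℝ ∞ (deriv z) s :=
  ((h.contDiffAt_center hs).fderiv_right (m := ∞) (by simp)).clm_apply contDiffAt_const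

theorem contDiffAt_deriv_radius (h : IsCanalHypersurface Ω Z z R) (hs : s ∈ Prod.fst '' Ω) :
    ContDiffAt ℝ ∞ (deriv R) s :=
  ((h.contDiffAt_radius hs).fderiv_right (m := ∞) (by simp)).clm_apply contDiffAt_const

theorem speed_sq_pos (hz : IsHyperbolicType Ω z) (hs : s ∈ Prod.fst '' Ω) :
    0 < minkowskiForm n (deriv z s) (deriv z s) + deriv R s ^ 2 :=
  add_pos_of_pos_of_nonneg (hz s hs) (sq_nonneg _)

theorem speed_pos (hz : IsHyperbolicType Ω z) (hp : p ∈ Ω) : 0 < canalSpeed z R p.1 :=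
  Real.sqrt_pos.2 (speed_sq_pos hz ⟨p, hp, rfl⟩)

theorem contDiffAt_speed (h : IsCanalHypersurface Ω Z z R) (hz : IsHyperbolicType Ω z)
    (hs : s ∈ Prod.fst '' Ω) : ContDiffAt ℝ ∞ (canalSpeed z R) s := by
  have h1 := h.contDiffAt_deriv_center hs
  exact (((contDiffAt_const.clm_apply h1).clm_apply h1).add
    ((h.contDiffAt_deriv_radius hs).pow 2)).sqrt (speed_sq_pos hz hs).ne'

theorem contDiffAt_direction (h : IsCanalHypersurface Ω Z z R) (hn : 1 ≤ n) (hp : p ∈ Ω) :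
    ContDiffAt ℝ ∞ (canalDirection Z z R) p :=
  ((h.contDiffAt_deriv_center ⟨p, hp, rfl⟩).comp p contDiffAt_fst).sub
    (((h.contDiffAt_deriv_radius ⟨p, hp, rfl⟩).comp p contDiffAt_fst).smul
      ((h.isSpaceLikeWithNormal hn).contDiffAt_normal hp))

theorem contDiffAt_inv_speed (h : IsCanalHypersurface Ω Z z R) (hz : IsHyperbolicType Ω z)
    (hs : s ∈ Prod.fst '' Ω) : ContDiffAt ℝ ∞ (fun t => (canalSpeed z R t)⁻¹) s :=
  (h.contDiffAt_speed hz hs).inv (Real.sqrt_pos.2 (speed_sq_pos hz hs)).ne'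

theorem contDiffAt_field (h : IsCanalHypersurface Ω Z z R) (hz : IsHyperbolicType Ω z)
    (hn : 1 ≤ n) (hp : p ∈ Ω) : ContDiffAt ℝ ∞ (canalField Z z R) p := by
  have h1 : ContDiffAt ℝ ∞ (canalUnitDirection Z z R) p :=
    ((h.contDiffAt_inv_speed hz ⟨p, hp, rfl⟩).comp p contDiffAt_fst).smul
      (h.contDiffAt_direction hn hp)
  exact (h.isSpaceLikeWithNormal hn).contDiffAt_inverse_firstForm hp
    ((contDiffAt_const.clm_apply h1).clm_comp
      ((h.isSpaceLikeWithNormal hn).contDiffAt_fderiv hp))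

theorem firstForm_field (h : IsCanalHypersurface Ω Z z R) (hn : 1 ≤ n) (hp : p ∈ Ω)
    (v : ParamSpace n) :
    firstForm (minkowskiForm n) Z p (canalField Z z R p) v
      = minkowskiForm n (canalUnitDirection Z z R p) (fderiv ℝ Z p v) := by
  rw [canalField, (h.isSpaceLikeWithNormal hn).firstForm_inverse hp]
  rfl

/-- The field is defined by duality, which makes its smoothness immediate. It represents the unit
direction itself, and not just a projection, because `z' - R' N` is orthogonal to `N`. -/
theorem fderiv_field (h : IsCanalHypersurface Ω Z z R) (hn : 1 ≤ n) (hp : p ∈ Ω) :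
    fderiv ℝ Z p (canalField Z z R p) = canalUnitDirection Z z R p := by
  rw [(h.isSpaceLikeWithNormal hn).fderiv_eq_of_firstForm_eq hp (h.firstForm_field hn hp)]
  simp [canalUnitDirection, h.minkowskiForm_direction_normal hn hp]

theorem isCanalStructuralField (h : IsCanalHypersurface Ω Z z R) (hz : IsHyperbolicType Ω z)
    (hn : 1 ≤ n) : IsCanalStructuralField Ω Z z R (canalField Z z R) := by
  intro p hp
  rw [h.fderiv_field hn hp, h.minkowskiForm_direction_direction hn hp]
  exact ⟨speed_sq_pos hz ⟨p, hp, rfl⟩, rfl⟩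

theorem firstForm_field_field (h : IsCanalHypersurface Ω Z z R) (hz : IsHyperbolicType Ω z)
    (hn : 1 ≤ n) (hp : p ∈ Ω) :
    firstForm (minkowskiForm n) Z p (canalField Z z R p) (canalField Z z R p) = 1 := by
  have h1 : canalSpeed z R p.1 ^ 2 = _ := Real.sq_sqrt (speed_sq_pos hz ⟨p, hp, rfl⟩).le
  have h2 := (speed_pos (R := R) hz hp).ne'
  rw [h.firstForm_field hn hp, h.fderiv_field hn hp]
  simp only [canalUnitDirection, map_smul, smul_apply, smul_eq_mul,
    h.minkowskiForm_direction_direction hn hp, ← h1]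
  field_simp

theorem radius_mul_secondForm (h : IsCanalHypersurface Ω Z z R) (hz : IsHyperbolicType Ω z)
    (hn : 1 ≤ n) (hp : p ∈ Ω) (X Y : ParamSpace n) :
    R p.1 * secondForm (minkowskiForm n) Z (canalNormal Z z R) p X Y
      = firstForm (minkowskiForm n) Z p X Y
        - canalSpeed z R p.1 * X.1
          * firstForm (minkowskiForm n) Z p (canalField Z z R p) Y := by
  have h2 := (speed_pos (R := R) hz hp).ne'
  have h3 := congrArg (fun V => minkowskiForm n V (fderiv ℝ Z p Y))
    (h.radius_smul_fderiv_normal hn hp X)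
  simp only [map_sub, map_smul, sub_apply, smul_apply, smul_eq_mul] at h3
  rw [(h.isSpaceLikeWithNormal hn).secondForm_eq hp, mul_neg, h3, h.firstForm_field hn hp,
    firstForm_apply]
  simp only [canalUnitDirection, map_smul, smul_apply, smul_eq_mul]
  field_simp
  ring

/-- The differential of the parameter `s` is proportional to the form dual to the structural
field. -/
theorem fst_eq (h : IsCanalHypersurface Ω Z z R) (hz : IsHyperbolicType Ω z) (hn : 1 ≤ n)
    (hp : p ∈ Ω) (X : ParamSpace n) :
    X.1 = (canalField Z z R p).1 * firstForm (minkowskiForm n) Z p (canalField Z z R p) X := by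
  have hH := h.isSpaceLikeWithNormal hn
  have h1 := h.radius_mul_secondForm hz hn hp X (canalField Z z R p)
  -- Symmetry of `II` equates `η(X) - λ ds(X)` with `η(X) - λ ds(ξ) η(X)`, since `η(ξ) = 1`.
  rw [hH.secondForm_symm hp, h.radius_mul_secondForm hz hn hp, hH.firstForm_symm p X,
    h.firstForm_field_field hz hn hp] at h1
  have h2 := (speed_pos (R := R) hz hp).ne'
  apply mul_left_cancel₀ h2
  linarith

theorem field_fst_ne_zero (h : IsCanalHypersurface Ω Z z R) (hz : IsHyperbolicType Ω z)
    (hn : 1 ≤ n) (hp : p ∈ Ω) : (canalField Z z R p).1 ≠ 0 := by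
  intro h0
  have := h.fst_eq hz hn hp (1, 0)
  rw [h0] at this
  simp at this

/-- Substitute `II = (g - λ ξ(s) η ⊗ η) / R` in the Gauss equation. The part quadratic in `g` gives
`π`, the mixed part gives `Φ`, and the part quartic in `η` cancels. -/
theorem curvatureTensor_eq (h : IsCanalHypersurface Ω Z z R) (hz : IsHyperbolicType Ω z)
    (hn : 1 ≤ n) (hp : p ∈ Ω) (X Y W U : ParamSpace n) :
    curvatureTensor (inducedMetric Z) p X Y W U
      = -1 / R p.1 ^ 2 * tensorPi (inducedMetric Z) p X Y W U
        + canalSpeed z R p.1 * (canalField Z z R p).1 / R p.1 ^ 2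
          * tensorPhi (inducedMetric Z) (canalField Z z R) p X Y W U := by
  have hR := (h.radius_pos_of_mem hp).ne'
  have hII : ∀ X Y, secondForm (minkowskiForm n) Z (canalNormal Z z R) p X Y
      = (firstForm (minkowskiForm n) Z p X Y
        - canalSpeed z R p.1 * ((canalField Z z R p).1
          * firstForm (minkowskiForm n) Z p (canalField Z z R p) X)
          * firstForm (minkowskiForm n) Z p (canalField Z z R p) Y) / R p.1 := fun X Y => by
    rw [← h.fst_eq hz hn hp X, ← h.radius_mul_secondForm hz hn hp, mul_div_cancel_left₀ _ hR]
  change curvatureTensor (firstForm (minkowskiForm n) Z) p X Y W U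
    = -1 / R p.1 ^ 2 * tensorPi (firstForm (minkowskiForm n) Z) p X Y W U
        + canalSpeed z R p.1 * (canalField Z z R p).1 / R p.1 ^ 2
          * tensorPhi (firstForm (minkowskiForm n) Z) (canalField Z z R) p X Y W U
  rw [(h.isSpaceLikeWithNormal hn).curvatureTensor_firstForm hp, hII, hII, hII, hII, tensorPi,
    tensorPhi]
  field_simp
  ring

theorem fderiv_comp_fst_apply {G : Type*} [NormedAddCommGroup G] [NormedSpace ℝ G] {f : ℝ → G}
    (hf : DifferentiableAt ℝ f p.1) {x : ParamSpace n} (hx : x.1 = 0) :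
    fderiv ℝ (fun q : ParamSpace n => f q.1) p x = 0 := by
  have := (hf.hasFDerivAt.comp p hasFDerivAt_fst).fderiv
  rw [show (fun q : ParamSpace n => f q.1) = f ∘ Prod.fst from rfl, this]
  simp [hx]

/-- When `ds(x) = 0`, the functions `z'`, `R'` and `λ` of `s` are constant to first order, so only
`N` contributes, through `dN(x) = -dZ(x)/R`. -/
theorem fderiv_unitDirection_apply (h : IsCanalHypersurface Ω Z z R) (hz : IsHyperbolicType Ω z)
    (hn : 1 ≤ n) (hp : p ∈ Ω) {x : ParamSpace n} (hx : x.1 = 0) :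
    fderiv ℝ (canalUnitDirection Z z R) p x
      = (deriv R p.1 / (R p.1 * canalSpeed z R p.1)) • fderiv ℝ Z p x := by
  have hs : p.1 ∈ Prod.fst '' Ω := ⟨p, hp, rfl⟩
  have hR := (h.radius_pos_of_mem hp).ne'
  have h1 := (h.contDiffAt_inv_speed hz hs).differentiableAt (by simp)
  have h2 := (h.contDiffAt_deriv_center hs).differentiableAt (by simp)
  have h3 := (h.contDiffAt_deriv_radius hs).differentiableAt (by simp)
  have h4 := ((h.isSpaceLikeWithNormal hn).contDiffAt_normal hp).differentiableAt (by simp)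
  have hfst : DifferentiableAt ℝ (fun q : ParamSpace n => q.1) p := differentiableAt_fst
  have hD : fderiv ℝ (canalDirection Z z R) p x
      = -(deriv R p.1 • fderiv ℝ (canalNormal Z z R) p x) := by
    have := (h2.comp p hfst).hasFDerivAt.fun_sub
      ((h3.comp p hfst).hasFDerivAt.fun_smul h4.hasFDerivAt)
    have e : fderiv ℝ (canalDirection Z z R) p = _ := this.fderiv
    rw [e]
    have e2 := fderiv_comp_fst_apply h2 hx
    have e3 := fderiv_comp_fst_apply h3 hx
    simp [Function.comp_def, e2, e3]
  have hN : fderiv ℝ (canalNormal Z z R) p x = -((R p.1)⁻¹ • fderiv ℝ Z p x) := by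
    have := h.radius_smul_fderiv_normal hn hp x
    rw [hx, zero_smul, zero_sub] at this
    rw [← smul_neg, ← this, inv_smul_smul₀ hR]
  have hU := (h1.comp p hfst).hasFDerivAt.fun_smul
    ((h.contDiffAt_direction hn hp).differentiableAt (by simp)).hasFDerivAt
  have e : fderiv ℝ (canalUnitDirection Z z R) p = _ := hU.fderiv
  have e1 := fderiv_comp_fst_apply h1 hx
  rw [e]
  simp only [Function.comp_def, add_apply, smul_apply, ContinuousLinearMap.smulRight_apply, e1,
    hD, hN, smul_neg, neg_neg, zero_smul, add_zero, smul_smul]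
  congr 1
  field_simp

theorem leviCivita_field (h : IsCanalHypersurface Ω Z z R) (hz : IsHyperbolicType Ω z)
    (hn : 1 ≤ n) (hp : p ∈ Ω) {x : ParamSpace n}
    (hx : inducedMetric Z p (canalField Z z R p) x = 0) :
    leviCivita (inducedMetric Z) (canalField Z z R) p x
      = (deriv R p.1 / (R p.1 * canalSpeed z R p.1)) • x := by
  have hH := h.isSpaceLikeWithNormal hn
  -- Orthogonality to `ξ` means tangency to the slices `s = const`, by `fst_eq`.
  have hx0 : x.1 = 0 := by
    have hx' : firstForm (minkowskiForm n) Z p (canalField Z z R p) x = 0 := hx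
    rw [h.fst_eq hz hn hp, hx', mul_zero]
  refine hH.firstForm_ext hp fun U => ?_
  have h1 : (fun q => fderiv ℝ Z q (canalField Z z R q)) =ᶠ[nhds p] canalUnitDirection Z z R := by
    filter_upwards [h.hypersurface.isOpen.mem_nhds hp] with q hq using h.fderiv_field hn hq
  refine (hH.firstForm_leviCivita hp
    ((h.contDiffAt_field hz hn hp).differentiableAt (by simp)) x U).trans ?_
  rw [h1.fderiv_eq, h.fderiv_unitDirection_apply hz hn hp hx0]
  simp

theorem fderiv_neg_one_div_radius_sq (h : IsCanalHypersurface Ω Z z R) (hp : p ∈ Ω)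
    (x : ParamSpace n) :
    fderiv ℝ (fun q : ParamSpace n => -1 / R q.1 ^ 2) p x
      = 2 * deriv R p.1 / R p.1 ^ 3 * x.1 := by
  have hR := (h.radius_pos_of_mem hp).ne'
  have h1 := ((h.contDiffAt_radius ⟨p, hp, rfl⟩).differentiableAt (by simp)).hasDerivAt
  have hfst : HasFDerivAt (fun q : ParamSpace n => q.1)
    (ContinuousLinearMap.fst ℝ ℝ (EuclideanSpace ℝ (Fin (n - 1)))) p := hasFDerivAt_fst
  have h2 := ((hasDerivAt_const p.1 (-1 : ℝ)).fun_div (h1.fun_pow 2)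
    (pow_ne_zero 2 hR)).comp_hasFDerivAt p hfst
  have e : fderiv ℝ (fun q : ParamSpace n => -1 / R q.1 ^ 2) p = _ := h2.fderiv
  rw [e]
  simp only [smul_apply, ContinuousLinearMap.coe_fst', smul_eq_mul]
  field_simp
  push_cast
  ring

theorem areCurvatureFunctions (h : IsCanalHypersurface Ω Z z R) (hz : IsHyperbolicType Ω z)
    (hn : 1 ≤ n) :
    AreCurvatureFunctions Ω (inducedMetric Z) (canalField Z z R) (fun p => -1 / R p.1 ^ 2)
      (fun p => canalSpeed z R p.1 * (canalField Z z R p).1 / R p.1 ^ 2)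
      (fun p => deriv R p.1 / (R p.1 * canalSpeed z R p.1)) where
  curvature _ hp := h.curvatureTensor_eq hz hn hp
  b_ne_zero _ hp := div_ne_zero (mul_ne_zero (speed_pos hz hp).ne' (h.field_fst_ne_zero hz hn hp))
    (pow_ne_zero 2 (h.radius_pos_of_mem hp).ne')
  umbilical _ hp _ hx := h.leviCivita_field hz hn hp hx
  k_eq p hp := by
    have h1 := (speed_pos (R := R) hz hp).ne'
    have h2 := h.field_fst_ne_zero hz hn hp
    have h3 := (h.radius_pos_of_mem hp).ne'
    rw [h.fderiv_neg_one_div_radius_sq hp]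
    field_simp

end IsCanalHypersurface

/-! ### From `𝓡 = a π + b Φ` to quasi-constant sectional curvatures. -/

section QuasiConstant

variable {E : Type*} [NormedAddCommGroup E] [NormedSpace ℝ E] {Ω : Set E}
  {g : E → E →L[ℝ] E →L[ℝ] ℝ} {ξ : E → E} {p : E}

/-- Bessel's inequality for an orthonormal pair. -/
theorem IsRiemannianMetricOn.sq_add_sq_le (hg : IsRiemannianMetricOn Ω g) (hp : p ∈ Ω)
    {v X Y : E} (hv : g p v v = 1) (hXY : IsOrthonormalPair g p X Y) :
    g p v X ^ 2 + g p v Y ^ 2 ≤ 1 := by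
  obtain ⟨hX, hY, hXY⟩ := hXY
  have hYX : g p Y X = 0 := by rw [hg.symm p hp, hXY]
  set w := v - g p v X • X - g p v Y • Y
  have hw : 0 ≤ g p w w := by
    by_cases h0 : w = 0
    · simp [h0]
    · exact (hg.pos p hp w h0).le
  have : g p w w = 1 - (g p v X ^ 2 + g p v Y ^ 2) := by
    simp only [w, map_sub, map_smul, sub_apply, smul_apply, smul_eq_mul, hX, hY, hXY, hYX, hv,
      hg.symm p hp X v, hg.symm p hp Y v]
    ring
  linarith

theorem AreCurvatureFunctions.isRiemannianQCManifold {a b k : E → ℝ}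
    (h : AreCurvatureFunctions Ω g ξ a b k) (hg : IsRiemannianMetricOn Ω g)
    (hξ : ContDiffOn ℝ ∞ ξ Ω) (hu : ∀ p ∈ Ω, g p (ξ p) (ξ p) = 1) :
    IsRiemannianQCManifold Ω g ξ where
  metric := hg
  smooth_field := hξ
  unit_field := hu
  quasiConstant p hp := by
    -- On an orthonormal pair `π(X, Y, Y, X) = 1` and `Φ(X, Y, Y, X) = η(X)² + η(Y)² = cos² θ`.
    -- Bessel's inequality keeps the argument of `arccos` in its range.
    refine ⟨fun θ => a p + b p * Real.cos θ ^ 2, fun X Y hXY => ?_⟩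
    have hB := hg.sq_add_sq_le hp (hu p hp) hXY
    have hnn : 0 ≤ g p (ξ p) X ^ 2 + g p (ξ p) Y ^ 2 := by positivity
    obtain ⟨hX, hY, hXY⟩ := hXY
    have hYX : g p Y X = 0 := by rw [hg.symm p hp, hXY]
    have hs := Real.sqrt_nonneg (g p (ξ p) X ^ 2 + g p (ξ p) Y ^ 2)
    beta_reduce
    rw [angleToPlane, Real.cos_arccos (by linarith) (Real.sqrt_le_one.2 hB), Real.sq_sqrt hnn,
      sectionalCurvature, h.curvature p hp]
    simp only [tensorPi, tensorPhi, hX, hY, hXY, hYX]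
    ring

end QuasiConstant

theorem proposition3p9 (n : ℕ) (hn : 4 ≤ n) (Ω : Set (ParamSpace n))
    (Z : ParamSpace n → MinkowskiSpace n) (z : ℝ → MinkowskiSpace n) (R : ℝ → ℝ)
    (hM : IsCanalHypersurface Ω Z z R) (hz : IsHyperbolicType Ω z) :
    ∃ ξ : ParamSpace n → ParamSpace n,
      IsCanalStructuralField Ω Z z R ξ ∧
      IsRiemannianQCManifold Ω (inducedMetric Z) ξ ∧
      ∃ a b k : ParamSpace n → ℝ,
        AreCurvatureFunctions Ω (inducedMetric Z) ξ a b k ∧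
        ∀ p ∈ Ω,
          a p = -1 / (R p.1) ^ 2 ∧
          a p + (k p) ^ 2 = -1 / ((R p.1) ^ 2 * ((radiusDeriv z R p.1) ^ 2 + 1)) ∧
          a p + (k p) ^ 2 < 0 := by
  have hn1 : 1 ≤ n := by omega
  have hcurv := hM.areCurvatureFunctions hz hn1
  refine ⟨canalField Z z R, hM.isCanalStructuralField hz hn1,
    hcurv.isRiemannianQCManifold (hM.isSpaceLikeWithNormal hn1).isRiemannianMetricOn
      (fun p hp => (hM.contDiffAt_field hz hn1 hp).contDiffWithinAt)
      (fun p hp => hM.firstForm_field_field hz hn1 hp), _, _, _, hcurv, fun p hp => ?_⟩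
  have hR := hM.radius_pos_of_mem hp
  have hzz := hz p.1 ⟨p, hp, rfl⟩
  have hspeed : canalSpeed z R p.1 ^ 2 = _ :=
    Real.sq_sqrt (IsCanalHypersurface.speed_sq_pos (R := R) hz ⟨p, hp, rfl⟩).le
  have hpos := IsCanalHypersurface.speed_sq_pos (R := R) hz ⟨p, hp, rfl⟩
  -- With `λ² = z'² + R'²` the left side is `-z'²/(R² λ²)`; dividing through by `z'² > 0` brings in
  -- `radiusDeriv`.
  have key : -1 / R p.1 ^ 2 + (deriv R p.1 / (R p.1 * canalSpeed z R p.1)) ^ 2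
      = -1 / ((R p.1) ^ 2 * ((radiusDeriv z R p.1) ^ 2 + 1)) := by
    rw [radiusDeriv, div_pow, div_pow, mul_pow, hspeed, Real.sq_sqrt hzz.le]
    have := hpos.ne'
    rw [div_add_one hzz.ne', add_comm (deriv R p.1 ^ 2)]
    field_simp
    ring
  refine ⟨rfl, key, ?_⟩
  rw [key]
  exact div_neg_of_neg_of_pos (by norm_num) (by positivity)
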